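/- **Setting.** For $\beta>0$, $K>0$ let $$c_\beta(t)=\log\frac{1+e^{-\beta}(e^t+e^{-t})}{1+2e^{-\beta}}\quad(t\in\mathbb R),\qquad J_\beta(x)=\sup_{t\in\mathbb R}\{tx-c_\beta(t)\}\quad(x\in[-1,1]),$$ $$I_{\beta,K}(x)=J_\beta(x)-\beta Kx^2-\inf_{y\in[-1,1]}\{J_\beta(y)-\beta Ky^2\},\qquad \mathcal M_{\beta,K}=\{x\in[-1,1]: I_{\beta,K}(x)=0\},$$ and let $G_{\beta,K}(x)=\beta Kx^2-c_\beta(2\beta Kx)$ for $x\in\mathbb R$ be the free-energy functional of the mean-field Blume–Capel model. $\mathcal M_{\beta,K}$ is the set of equilibrium values of the magnetization, and the magnetization $m(\beta,K)$ is its largest element; thus if $\mathcal M_{\beta,K}=\{\pm m\}$ with $m>0$, then $m(\beta,K)=m$. Put $\beta_c=\log 4$, $K(\beta)=(e^\beta+2)/(4\beta)$ and $c_4(\beta)=(e^\beta+2)^2(4-e^\beta)/(8\cdot 4!)$. **Theorem 3.2.** Let $0<\beta<\beta_c$, $\alpha>0$, $b\in\{1,-1\}$, let $p\ge 2$ be an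 integer and let $\ell\in\mathbb R$ with $\ell\ne K^{(p)}(\beta)$. For $n\in\mathbb N$ define $$\beta_n=\beta+\frac{b}{n^\alpha},\qquad K_n=K(\beta)+\sum_{j=1}^{p-1}\frac{K^{(j)}(\beta)\,b^j}{j!\,n^{j\alpha}}+\frac{\ell\, b^p}{p!\,n^{p\alpha}}.$$ Then $(\beta_n,K_n)\to(\beta,K(\beta))$ as $n\to\infty$, and the following hold. (a) With $u=1-2p\alpha$ and $\gamma=p\alpha/2$, $$n^{1-u}G_{\beta_n,K_n}(x/n^\gamma)\to g(x)=\tfrac1{p!}\,\beta\,(K^{(p)}(\beta)-\ell)\,b^p\,x^2+c_4(\beta)\,x^4$$ uniformly for $x$ in compact subsets of $\mathbb R$. (b) The polynomial $g$ has a nonzero global minimum point if and only if $(K^{(p)}(\beta)-\ell)b^p<0$. If this inequality holds, then the set of global minimum points of $g$ is $\{\pm\bar x\}$, where $$\bar x=\left(\frac{\beta(\ell-K^{(p)}(\beta))b^p}{2c_4(\beta)\,p!}\right)^{1/2}>0.$$ (c) Assume that $(K^{(p)}(\beta)-\ell)b^p<0$. Then for all sufficiently large $n$ one has $m(\beta_n,K_n)>0$,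 and $\{\pm m(\beta_n,K_n)\}$ is both $\mathcal M_{\beta_n,K_n}$ and the set of global minimum points of $G_{\beta_n,K_n}$. Moreover $m(\beta_n,K_n)\to 0$ and $$\lim_{n\to\infty}n^{p\alpha/2}\,m(\beta_n,K_n)=\bar x,\qquad\text{i.e.}\qquad m(\beta_n,K_n)\sim\bar x\,|\beta-\beta_n|^{p/2}.$$ -/

import Mathlib

open Filter Topology

noncomputable section

namespace BlumeCapel

/-- The critical inverse temperature `β_c = log 4`. -/
def betaC : ℝ := Real.log 4

/-- The cumulant generating function `c_β(t) = log ∫ exp(tω) ρ_β(dω)` of the single-site law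
`ρ_β` on `{-1, 0, 1}`, whose weights are proportional to `exp(-β ω²)`. -/
def cgfSpin (β t : ℝ) : ℝ :=
  Real.log ((1 + Real.exp (-β) * (Real.exp t + Real.exp (-t))) / (1 + 2 * Real.exp (-β)))

/-- The Legendre-Fenchel transform `J_β(x) = sup_t (t x - c_β(t))`; the supremum is over a
bounded family for `x ∈ [-1, 1]`, the only points where it is used. -/
def legendreJ (β x : ℝ) : ℝ := ⨆ t : ℝ, (t * x - cgfSpin β t)

/-- The rate function `I_{β,K}` of the spin per site `S_N / N` in the canonical ensemble, on
`[-1, 1]`. -/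
def rateI (β K x : ℝ) : ℝ :=
  legendreJ β x - β * K * x ^ 2 -
    ⨅ y : Set.Icc (-1 : ℝ) 1, (legendreJ β (y : ℝ) - β * K * (y : ℝ) ^ 2)

/-- The set `ℳ_{β,K}` of equilibrium values of the magnetization: the zeroes of the rate
function in `[-1, 1]`. -/
def equilibria (β K : ℝ) : Set ℝ := {x | x ∈ Set.Icc (-1 : ℝ) 1 ∧ rateI β K x = 0}

/-- The magnetization `m(β, K)`, the largest equilibrium value. Where
`ℳ_{β,K} = {m, -m}` with `m > 0`, this is that `m`. -/
def magnetization (β K : ℝ) : ℝ := sSup (equilibria β K)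

/-- The free-energy functional `G_{β,K}(x) = β K x² - c_β(2 β K x)`. -/
def freeEnergy (β K x : ℝ) : ℝ := β * K * x ^ 2 - cgfSpin β (2 * β * K * x)

/-- The second-order curve `K(β) = (e^β + 2) / (4 β)`. -/
def curveK (β : ℝ) : ℝ := (Real.exp β + 2) / (4 * β)

/-- The quartic coefficient `c_4(β) = (e^β + 2)² (4 - e^β) / (8 · 4!)`. -/
def c4 (β : ℝ) : ℝ :=
  (Real.exp β + 2) ^ 2 * (4 - Real.exp β) / (8 * (Nat.factorial 4 : ℝ))

/-- The sequence `β_n = β + b / n^α`. -/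
def betaSeq (β α b : ℝ) (n : ℕ) : ℝ := β + b / (n : ℝ) ^ α

/-- The sequence
`K_n = K(β) + ∑_{j=1}^{p-1} K^{(j)}(β) b^j / (j! n^{jα}) + ℓ b^p / (p! n^{pα})`. -/
def KSeq (β α b : ℝ) (p : ℕ) (l : ℝ) (n : ℕ) : ℝ :=
  curveK β
    + ∑ j ∈ Finset.Icc 1 (p - 1),
        iteratedDeriv j curveK β * b ^ j / ((j.factorial : ℝ) * (n : ℝ) ^ ((j : ℝ) * α))
    + l * b ^ p / ((p.factorial : ℝ) * (n : ℝ) ^ ((p : ℝ) * α))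

/-- The Ginzburg-Landau polynomial
`g(x) = (1/p!) β (K^{(p)}(β) - ℓ) b^p x² + c_4(β) x⁴`. -/
def glPoly (β b : ℝ) (p : ℕ) (l x : ℝ) : ℝ :=
  1 / (p.factorial : ℝ) * β * (iteratedDeriv p curveK β - l) * b ^ p * x ^ 2 + c4 β * x ^ 4

/-- The point `x̄ = (β (ℓ - K^{(p)}(β)) b^p / [2 c_4(β) p!])^{1/2}`. -/
def xbar (β b : ℝ) (p : ℕ) (l : ℝ) : ℝ :=
  Real.sqrt (β * (l - iteratedDeriv p curveK β) * b ^ p / (2 * c4 β * (p.factorial : ℝ)))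

/-- The set of global minimum points of a real function. -/
def globalMinPoints (f : ℝ → ℝ) : Set ℝ := {x | ∀ y, f x ≤ f y}

end BlumeCapel

end

/-! Write w for the variance of the single-site law. The cumulant generating function is log(1 +
w(cosh t - 1)) = w t²/2 + w(1 - 3w) t⁴/24 + O(t⁶), so G has quadratic coefficient proportional to
K(β) - K. Since K_n is the Taylor polynomial of K(·) at β_n with its p-th coefficient replaced by ℓ,
the gap K(β_n) - K_n has exact order n^{-pα}. At x/n^{pα/2} the quadratic and quartic terms of G
then both have order n^{-2pα} and the remainder has order n^{-3pα}, which gives (a)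
(`tendstoUniformlyOn_freeEnergy`). Part (b) is completing the square in g.

For (c), convex duality (`equilibria_eq_globalMinPoints`) replaces the rate function by G. Below β_c
one has w > 1/3, which makes the mean strictly concave on [0, ∞) (`strictConcaveOn_cgfMean`). Hence,
once G takes a negative value, it strictly decreases on [0, m] and strictly increases on [m, ∞)
(`magnetization_spec`). With this shape, comparing G at two points locates m, so pointwise
convergence to g alone forces n^{pα/2} m → x̄; no compactness of minimizers is needed. -/

namespace BlumeCapel

/-! ### Single-site law: variance, mean and cumulant generating function -/

/-- The variance `2 / (e^β + 2)` of the single-site law `ρ_β`. -/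
noncomputable def spinVar (β : ℝ) : ℝ := 2 / (Real.exp β + 2)

lemma spinVar_pos (β : ℝ) : 0 < spinVar β := by
  unfold spinVar; positivity

lemma spinVar_lt_one (β : ℝ) : spinVar β < 1 := by
  unfold spinVar
  rw [div_lt_one (by positivity)]
  linarith [Real.exp_pos β]

lemma exp_lt_four {β : ℝ} (hβ : β < betaC) : Real.exp β < 4 :=
  (Real.lt_log_iff_exp_lt (by norm_num)).1 hβ

/-- The value 1/3 is where the fourth cumulant w(1 - 3w) changes sign, and it corresponds to β = log
4. -/
lemma third_lt_spinVar {β : ℝ} (hβ : β < betaC) : 1 / 3 < spinVar β := by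
  unfold spinVar
  rw [div_lt_div_iff₀ (by norm_num) (by positivity)]
  linarith [exp_lt_four hβ]

lemma c4_pos {β : ℝ} (hβ : β < betaC) : 0 < c4 β := by
  have := exp_lt_four hβ
  have h4 : 0 < 4 - Real.exp β := by linarith
  unfold c4
  positivity

/-- The cumulant generating function in terms of the variance `w`. -/
noncomputable def cgfVar (w t : ℝ) : ℝ := Real.log (1 + w * (Real.cosh t - 1))

lemma cgfSpin_eq (β t : ℝ) : cgfSpin β t = cgfVar (spinVar β) t := by
  unfold cgfSpin cgfVar spinVar
  congr 1
  rw [Real.cosh_eq, Real.exp_neg β]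
  have := Real.exp_pos β
  field_simp
  ring

lemma one_add_cosh_pos {w : ℝ} (hw : 0 < w) (t : ℝ) : 0 < 1 + w * (Real.cosh t - 1) := by
  have : 0 ≤ w * (Real.cosh t - 1) := mul_nonneg hw.le (by linarith [Real.one_le_cosh t])
  linarith

@[simp] lemma cgfVar_zero (w : ℝ) : cgfVar w 0 = 0 := by simp [cgfVar]

@[simp] lemma cgfVar_neg (w t : ℝ) : cgfVar w (-t) = cgfVar w t := by simp [cgfVar]

/-- Derivative of the cumulant generating function. -/
noncomputable def cgfMean (w t : ℝ) : ℝ := w * Real.sinh t / (1 + w * (Real.cosh t - 1))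

lemma hasDerivAt_denom (w t : ℝ) :
    HasDerivAt (fun t => 1 + w * (Real.cosh t - 1)) (w * Real.sinh t) t :=
  (((Real.hasDerivAt_cosh t).sub_const 1).const_mul w).const_add 1

lemma hasDerivAt_cgfVar {w : ℝ} (hw : 0 < w) (t : ℝ) :
    HasDerivAt (cgfVar w) (cgfMean w t) t :=
  (hasDerivAt_denom w t).log (one_add_cosh_pos hw t).ne'

lemma hasDerivAt_cgfMean {w : ℝ} (hw : 0 < w) (t : ℝ) :
    HasDerivAt (cgfMean w)
      (w * ((1 - w) * Real.cosh t + w) / (1 + w * (Real.cosh t - 1)) ^ 2) t := by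
  have h := ((Real.hasDerivAt_sinh t).const_mul w).div (hasDerivAt_denom w t)
    (one_add_cosh_pos hw t).ne'
  refine h.congr_deriv ?_
  congr 1
  linear_combination (w ^ 2) * Real.cosh_sq_sub_sinh_sq t

lemma hasDerivAt_deriv_cgfMean {w : ℝ} (hw : 0 < w) (t : ℝ) :
    HasDerivAt (fun t => w * ((1 - w) * Real.cosh t + w) / (1 + w * (Real.cosh t - 1)) ^ 2)
      (w * Real.sinh t * ((1 - w) ^ 2 - w * (1 - w) * Real.cosh t - 2 * w ^ 2) /
        (1 + w * (Real.cosh t - 1)) ^ 3) t := by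
  have hD := (one_add_cosh_pos hw t).ne'
  have h := ((((Real.hasDerivAt_cosh t).const_mul (1 - w)).add_const w).const_mul w).div
    ((hasDerivAt_denom w t).pow 2) (pow_ne_zero 2 hD)
  refine h.congr_deriv ?_
  simp only [Pi.pow_apply]
  field_simp
  ring

/-- For t > 0 the second derivative has the sign of (1 - 3w) - w(1 - w)(cosh t - 1), whose first
term is nonpositive exactly when w ≥ 1/3. -/
lemma strictConcaveOn_cgfMean {w : ℝ} (hw : 1 / 3 ≤ w) (hw1 : w < 1) :
    StrictConcaveOn ℝ (Set.Ici 0) (cgfMean w) := by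
  have hw0 : 0 < w := by linarith
  refine strictConcaveOn_of_deriv2_neg (convex_Ici 0)
    (fun t _ => (hasDerivAt_cgfMean hw0 t).continuousAt.continuousWithinAt) fun t ht => ?_
  rw [interior_Ici, Set.mem_Ioi] at ht
  have h1 : deriv (cgfMean w) = _ := funext fun s => (hasDerivAt_cgfMean hw0 s).deriv
  rw [Function.iterate_succ_apply, Function.iterate_one, h1,
    (hasDerivAt_deriv_cgfMean hw0 t).deriv]
  have hs : 0 < Real.sinh t := Real.sinh_pos_iff.2 ht
  have hc : 1 < Real.cosh t := Real.one_lt_cosh.2 ht.ne'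
  refine div_neg_of_neg_of_pos (mul_neg_of_pos_of_neg (by positivity) ?_)
    (pow_pos (one_add_cosh_pos hw0 t) 3)
  have : 0 < w * (1 - w) * (Real.cosh t - 1) := by
    have : 0 < 1 - w := by linarith
    have : 0 < Real.cosh t - 1 := by linarith
    positivity
  nlinarith

lemma convexOn_cgfVar {w : ℝ} (hw : 0 < w) (hw1 : w < 1) :
    ConvexOn ℝ Set.univ (cgfVar w) := by
  have h0 : deriv (cgfVar w) = cgfMean w := funext fun s => (hasDerivAt_cgfVar hw s).deriv
  have h1 : deriv (cgfMean w) = _ := funext fun s => (hasDerivAt_cgfMean hw s).deriv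
  refine convexOn_univ_of_deriv2_nonneg (fun t => (hasDerivAt_cgfVar hw t).differentiableAt)
    (h0 ▸ fun t => (hasDerivAt_cgfMean hw t).differentiableAt) fun t => ?_
  rw [Function.iterate_succ_apply, Function.iterate_one, h0, h1]
  have : 0 < 1 - w := by linarith
  have := Real.cosh_pos t
  positivity

lemma abs_cgfMean_le_one {w : ℝ} (hw : 0 < w) (hw1 : w < 1) (t : ℝ) : |cgfMean w t| ≤ 1 := by
  have hD := one_add_cosh_pos hw t
  unfold cgfMean
  rw [abs_div, abs_of_pos hD, div_le_one hD, abs_mul, abs_of_pos hw]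
  have : |Real.sinh t| ≤ Real.cosh t := by
    rw [← abs_of_pos (Real.cosh_pos t), ← sq_le_sq, Real.cosh_sq]
    linarith
  nlinarith

/-- A convex function lies above its tangent lines. -/
lemma cgfVar_tangent {w : ℝ} (hw : 0 < w) (hw1 : w < 1) (s t : ℝ) :
    cgfVar w s + cgfMean w s * (t - s) ≤ cgfVar w t := by
  have hc := convexOn_cgfVar hw hw1
  rcases lt_trichotomy s t with h | rfl | h
  · have := hc.le_slope_of_hasDerivAt (Set.mem_univ s) (Set.mem_univ t) h (hasDerivAt_cgfVar hw s)
    rw [slope_def_field, le_div_iff₀ (by linarith)] at this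
    linarith
  · simp
  · have := hc.slope_le_of_hasDerivAt (Set.mem_univ t) (Set.mem_univ s) h (hasDerivAt_cgfVar hw s)
    rw [slope_def_field, div_le_iff₀ (by linarith)] at this
    linarith

/-- Linear growth, against the quadratic term of G, makes G nonnegative far from the origin. -/
lemma cgfVar_le_abs {w : ℝ} (hw : 0 < w) (hw1 : w < 1) (t : ℝ) : cgfVar w t ≤ |t| := by
  unfold cgfVar
  rw [Real.log_le_iff_le_exp (one_add_cosh_pos hw t)]
  have h1 : Real.cosh t ≤ Real.exp |t| := by
    rw [← Real.cosh_abs, Real.cosh_eq]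
    have : Real.exp (-|t|) ≤ Real.exp |t| :=
      Real.exp_le_exp.2 (by linarith [abs_nonneg t])
    linarith
  nlinarith [Real.one_le_cosh t]

/-- Bounds the family in the Legendre transform for every |x| ≤ 1, endpoints included. -/
lemma abs_add_log_le_cgfVar {w : ℝ} (hw : 0 < w) (hw1 : w < 1) (t : ℝ) :
    |t| + Real.log (w / 2) ≤ cgfVar w t := by
  unfold cgfVar
  rw [Real.le_log_iff_exp_le (one_add_cosh_pos hw t), Real.exp_add,
    Real.exp_log (by positivity), ← Real.cosh_abs, Real.cosh_eq]
  nlinarith [Real.exp_pos (-|t|), Real.exp_pos |t|]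

/-! ### Fourth-order expansion of the cumulant generating function -/

lemma abs_cosh_sub_le {t : ℝ} (ht : |t| ≤ 1) :
    |Real.cosh t - 1 - t ^ 2 / 2 - t ^ 4 / 24| ≤ t ^ 6 / 600 := by
  have h6 : |t| ^ 6 = t ^ 6 := by rw [show 6 = 2 * 3 by norm_num, pow_mul, sq_abs, ← pow_mul]
  -- Averaging the expansions at t and -t cancels the odd terms; the resulting constant 7/4320 is
  -- below 1/600.
  have h1 := Real.exp_bound ht (n := 6) (by norm_num)
  have h2 := Real.exp_bound (x := -t) (by rwa [abs_neg]) (n := 6) (by norm_num)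
  rw [abs_neg] at h2
  rw [h6, abs_le] at h1 h2
  simp only [Finset.sum_range_succ, Finset.sum_range_zero, Nat.factorial] at h1 h2
  norm_num at h1 h2
  have : 0 ≤ t ^ 6 := by positivity
  rw [abs_le, Real.cosh_eq]
  constructor <;> linarith [h1.1, h1.2, h2.1, h2.2]

/-- Fourth-order expansion of the cumulant generating function, uniform in the variance. -/
lemma abs_cgfVar_sub_le {w t : ℝ} (hw : 0 < w) (hw1 : w < 1) (ht : |t| ≤ 1) :
    |cgfVar w t - w * t ^ 2 / 2 - (w / 24 - w ^ 2 / 8) * t ^ 4| ≤ 5 * t ^ 6 := by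
  obtain ⟨e, he⟩ : ∃ e, e = Real.cosh t - 1 - t ^ 2 / 2 - t ^ 4 / 24 := ⟨_, rfl⟩
  have hE := abs_cosh_sub_le ht
  rw [← he] at hE
  have ht2 : t ^ 2 ≤ 1 := by rwa [sq_le_one_iff_abs_le_one]
  have ht20 : 0 ≤ t ^ 2 := sq_nonneg t
  have h64 : t ^ 6 ≤ t ^ 4 := by nlinarith [mul_nonneg (sq_nonneg (t ^ 2)) (sub_nonneg.2 ht2)]
  have h42 : t ^ 4 ≤ t ^ 2 := by nlinarith
  have h60 : 0 ≤ t ^ 6 := by positivity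
  obtain ⟨s, hs⟩ : ∃ s, s = Real.cosh t - 1 := ⟨_, rfl⟩
  have hs0 : 0 ≤ s := by linarith [Real.one_le_cosh t]
  have hse : s = t ^ 2 / 2 + t ^ 4 / 24 + e := by rw [hs, he]; ring
  obtain ⟨he1, he2⟩ := abs_le.1 hE
  have hs2 : s ≤ 3 / 5 * t ^ 2 := by linarith
  have hz0 : 0 ≤ w * s := by positivity
  have hzs : w * s ≤ s := by nlinarith
  have hz : w * s ≤ 3 / 5 := by linarith
  -- With z = w(cosh t - 1) ≤ 3/5, log(1 + z) = z - z²/2 up to z³/(1 - z).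
  have hlog := Real.abs_log_sub_add_sum_range_le (x := -(w * s))
    (by rw [abs_neg, abs_of_nonneg hz0]; linarith) 2
  rw [abs_neg, abs_of_nonneg hz0, sub_neg_eq_add] at hlog
  norm_num [Finset.sum_range_succ] at hlog
  have hb : (w * s) ^ 3 / (1 - w * s) ≤ t ^ 6 := by
    rw [div_le_iff₀ (by linarith)]
    have h3 : (w * s) ^ 3 ≤ (3 / 5 * t ^ 2) ^ 3 :=
      pow_le_pow_left₀ hz0 (hzs.trans hs2) 3
    have h4 : (3 / 5 * t ^ 2) ^ 3 ≤ t ^ 6 * (2 / 5) := by nlinarith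
    have h5 : t ^ 6 * (2 / 5) ≤ t ^ 6 * (1 - w * s) :=
      mul_le_mul_of_nonneg_left (by linarith) h60
    linarith
  obtain ⟨hl1, hl2⟩ := abs_le.1 (hlog.trans hb)
  have hr1 : 0 ≤ s - t ^ 2 / 2 := by
    have : t ^ 6 / 600 ≤ t ^ 4 / 24 := by nlinarith [sq_nonneg (t ^ 2)]
    linarith
  have hr2 : s - t ^ 2 / 2 ≤ t ^ 4 / 2 := by linarith [sq_nonneg (t ^ 2)]
  have hr : (s - t ^ 2 / 2) * (s + t ^ 2 / 2) ≤ t ^ 6 := by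
    calc _ ≤ (t ^ 4 / 2) * (2 * t ^ 2) :=
          mul_le_mul hr2 (by linarith) (by positivity) (by positivity)
      _ = t ^ 6 := by ring
  have hr0 : 0 ≤ (s - t ^ 2 / 2) * (s + t ^ 2 / 2) := mul_nonneg hr1 (by positivity)
  -- Three errors, each at most t⁶ in absolute value: the logarithm's remainder, that of cosh, and
  -- the replacement of s² by t⁴/4 in the quadratic term.
  have hkey : cgfVar w t - w * t ^ 2 / 2 - (w / 24 - w ^ 2 / 8) * t ^ 4 =
      (-(w * s) + (w * s) ^ 2 / 2 + Real.log (1 + w * s)) + w * e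
        - w ^ 2 / 2 * ((s - t ^ 2 / 2) * (s + t ^ 2 / 2)) := by
    unfold cgfVar
    rw [← hs]
    have : e = s - t ^ 2 / 2 - t ^ 4 / 24 := by rw [hse]; ring
    rw [this]; ring
  have hw2 : w ^ 2 / 2 ≤ 1 := by nlinarith
  have hwr : w ^ 2 / 2 * ((s - t ^ 2 / 2) * (s + t ^ 2 / 2)) ≤ t ^ 6 :=
    (mul_le_of_le_one_left hr0 hw2).trans hr
  have hwr0 : 0 ≤ w ^ 2 / 2 * ((s - t ^ 2 / 2) * (s + t ^ 2 / 2)) := by positivity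
  have hwe : |w * e| ≤ t ^ 6 := by
    rw [abs_mul, abs_of_pos hw]
    nlinarith [abs_nonneg e]
  obtain ⟨hwe1, hwe2⟩ := abs_le.1 hwe
  rw [hkey, abs_le]
  constructor <;> linarith

/-! ### Free-energy functional and convex duality -/

lemma freeEnergy_eq (β K x : ℝ) :
    freeEnergy β K x = β * K * x ^ 2 - cgfVar (spinVar β) (2 * β * K * x) := by
  rw [freeEnergy, cgfSpin_eq]

@[simp] lemma freeEnergy_zero (β K : ℝ) : freeEnergy β K 0 = 0 := by
  simp [freeEnergy_eq]

@[simp] lemma freeEnergy_neg (β K x : ℝ) : freeEnergy β K (-x) = freeEnergy β K x := by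
  simp [freeEnergy_eq]

lemma hasDerivAt_freeEnergy (β K x : ℝ) :
    HasDerivAt (freeEnergy β K)
      (2 * β * K * (x - cgfMean (spinVar β) (2 * β * K * x))) x := by
  have h := ((hasDerivAt_pow 2 x).const_mul (β * K)).sub
    ((hasDerivAt_cgfVar (spinVar_pos β) (2 * β * K * x)).comp x
      ((hasDerivAt_id x).const_mul (2 * β * K)))
  rw [funext (freeEnergy_eq β K)]
  refine h.congr_deriv ?_
  push_cast
  ring

lemma continuous_freeEnergy (β K : ℝ) : Continuous (freeEnergy β K) :=
  continuous_iff_continuousAt.2 fun x => (hasDerivAt_freeEnergy β K x).continuousAt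

lemma globalMinPoints_freeEnergy_nonempty {β K : ℝ} (hK : 0 < β * K) :
    (globalMinPoints (freeEnergy β K)).Nonempty := by
  refine (continuous_freeEnergy β K).exists_forall_le' 0 ?_
  -- Outside [-2, 2], c(2βKx) ≤ 2βK|x| ≤ βKx², so G is at least G(0) = 0 there.
  filter_upwards [(isCompact_Icc (a := (-2 : ℝ)) (b := 2)).compl_mem_cocompact] with x hx
  rw [freeEnergy_zero, freeEnergy_eq, sub_nonneg]
  have h2 : 2 ≤ |x| := by
    by_contra! h
    exact hx ⟨(abs_lt.1 h).1.le, (abs_lt.1 h).2.le⟩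
  have h := cgfVar_le_abs (spinVar_pos β) (spinVar_lt_one β) (2 * β * K * x)
  rw [show 2 * β * K * x = 2 * (β * K) * x by ring, abs_mul,
    abs_of_pos (by positivity : 0 < 2 * (β * K))] at h
  rw [show 2 * β * K * x = 2 * (β * K) * x by ring, ← sq_abs x]
  nlinarith [mul_nonneg (mul_nonneg hK.le (abs_nonneg x)) (sub_nonneg.2 h2)]

lemma eq_cgfMean_of_mem_globalMinPoints {β K x : ℝ} (hK : 0 < β * K)
    (hx : x ∈ globalMinPoints (freeEnergy β K)) :
    x = cgfMean (spinVar β) (2 * β * K * x) := by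
  have hmin : IsLocalMin (freeEnergy β K) x := Filter.Eventually.of_forall hx
  have h := hmin.hasDerivAt_eq_zero (hasDerivAt_freeEnergy β K x)
  rw [show 2 * β * K = 2 * (β * K) by ring] at h ⊢
  have := (mul_eq_zero.1 h).resolve_left (by positivity)
  linarith

lemma bddAbove_range_legendre (β : ℝ) {x : ℝ} (hx : x ∈ Set.Icc (-1 : ℝ) 1) :
    BddAbove (Set.range fun t : ℝ => t * x - cgfSpin β t) := by
  refine ⟨-Real.log (spinVar β / 2), ?_⟩
  rintro _ ⟨t, rfl⟩
  have h := abs_add_log_le_cgfVar (spinVar_pos β) (spinVar_lt_one β) t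
  have h1 : t * x ≤ |t| :=
    calc t * x ≤ |t * x| := le_abs_self _
      _ = |t| * |x| := abs_mul _ _
      _ ≤ |t| := mul_le_of_le_one_right (abs_nonneg t) (abs_le.2 hx)
  simp only [cgfSpin_eq]
  linarith

lemma freeEnergy_le_legendreJ_sub (β K : ℝ) {x : ℝ} (hx : x ∈ Set.Icc (-1 : ℝ) 1) :
    freeEnergy β K x ≤ legendreJ β x - β * K * x ^ 2 := by
  have h := le_ciSup (bddAbove_range_legendre β hx) (2 * β * K * x)
  unfold freeEnergy legendreJ
  linarith

/-- When x is the mean at t = 2βKx, the tangent-line inequality says that this t attains the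
supremum defining J. -/
lemma legendreJ_sub_eq_freeEnergy {β K x : ℝ}
    (hx : x = cgfMean (spinVar β) (2 * β * K * x)) :
    legendreJ β x - β * K * x ^ 2 = freeEnergy β K x := by
  have hx1 : x ∈ Set.Icc (-1 : ℝ) 1 := by
    rw [hx]
    exact abs_le.1 (abs_cgfMean_le_one (spinVar_pos β) (spinVar_lt_one β) _)
  refine le_antisymm ?_ (freeEnergy_le_legendreJ_sub β K hx1)
  have h : legendreJ β x ≤ 2 * β * K * x * x - cgfVar (spinVar β) (2 * β * K * x) := by
    refine ciSup_le fun t => ?_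
    have := cgfVar_tangent (spinVar_pos β) (spinVar_lt_one β) (2 * β * K * x) t
    rw [← hx] at this
    rw [cgfSpin_eq]
    linarith
  rw [freeEnergy_eq]
  linarith

/-- Convex duality: the equilibrium macrostates are the global minimum points of the free-energy
functional. -/
lemma equilibria_eq_globalMinPoints {β K : ℝ} (hK : 0 < β * K) :
    equilibria β K = globalMinPoints (freeEnergy β K) := by
  have hcrit {x : ℝ} (hx : x ∈ globalMinPoints (freeEnergy β K)) :=
    eq_cgfMean_of_mem_globalMinPoints hK hx
  have hIcc {x : ℝ} (hx : x ∈ globalMinPoints (freeEnergy β K)) : x ∈ Set.Icc (-1 : ℝ) 1 := by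
    rw [hcrit hx]
    exact abs_le.1 (abs_cgfMean_le_one (spinVar_pos β) (spinVar_lt_one β) _)
  obtain ⟨x₀, hx₀⟩ := globalMinPoints_freeEnergy_nonempty hK
  -- G lies below J - βK(·)² on [-1, 1] and touches it at the minimizers of G. These are means,
  -- hence lie in [-1, 1], so both minima agree.
  have hinf : ⨅ y : Set.Icc (-1 : ℝ) 1, (legendreJ β (y : ℝ) - β * K * (y : ℝ) ^ 2) =
      freeEnergy β K x₀ := by
    have hle (y : Set.Icc (-1 : ℝ) 1) :
        freeEnergy β K x₀ ≤ legendreJ β (y : ℝ) - β * K * (y : ℝ) ^ 2 :=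
      (hx₀ _).trans (freeEnergy_le_legendreJ_sub β K y.2)
    have : Nonempty (Set.Icc (-1 : ℝ) 1) := ⟨⟨x₀, hIcc hx₀⟩⟩
    refine le_antisymm ?_ (le_ciInf hle)
    rw [← legendreJ_sub_eq_freeEnergy (hcrit hx₀)]
    exact ciInf_le ⟨freeEnergy β K x₀, by rintro _ ⟨y, rfl⟩; exact hle y⟩
      (⟨x₀, hIcc hx₀⟩ : Set.Icc (-1 : ℝ) 1)
  ext x
  constructor
  · rintro ⟨hx, hx0⟩ y
    rw [rateI, hinf] at hx0
    have := freeEnergy_le_legendreJ_sub β K hx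
    have := hx₀ y
    linarith
  · intro hx
    refine ⟨hIcc hx, ?_⟩
    rw [rateI, hinf, legendreJ_sub_eq_freeEnergy (hcrit hx)]
    exact sub_eq_zero.2 (le_antisymm (hx x₀) (hx₀ x))

/-! ### Shape of the free energy below the critical inverse temperature -/

/-- The difference quotient at the origin of the mean is strictly decreasing. -/
lemma div_mul_cgfMean_lt {w s t : ℝ} (hw : 1 / 3 ≤ w) (hw1 : w < 1) (hs : 0 < s) (hst : s < t) :
    s / t * cgfMean w t < cgfMean w s := by
  have ht : 0 < t := hs.trans hst
  -- Strict concavity on the chord from 0 to t, evaluated at s; the mean vanishes at 0.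
  have h := (strictConcaveOn_cgfMean hw hw1).2 Set.self_mem_Ici (Set.mem_Ici.2 ht.le) ht.ne
    (sub_pos.2 ((div_lt_one ht).2 hst)) (div_pos hs ht) (sub_add_cancel 1 (s / t))
  have h0 : cgfMean w 0 = 0 := by simp [cgfMean]
  simpa only [smul_eq_mul, h0, mul_zero, zero_add, div_mul_cancel₀ s ht.ne'] using h

/-- G′(x) has the sign of x - c′(2βKx). Since c′(2βKm) = m, the strictly decreasing quotient
c′(2βKx)/x exceeds 1 before m; after m it is below 1, which gives the companion monotonicity lemma.
-/
lemma strictAntiOn_freeEnergy {β K m : ℝ} (hβ : β < betaC) (hK : 0 < β * K) (hm : 0 < m)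
    (hcrit : m = cgfMean (spinVar β) (2 * β * K * m)) :
    StrictAntiOn (freeEnergy β K) (Set.Icc 0 m) := by
  have hq : 0 < 2 * β * K := by linarith
  refine strictAntiOn_of_deriv_neg (convex_Icc 0 m) (continuous_freeEnergy β K).continuousOn
    fun x hx => ?_
  rw [interior_Icc] at hx
  rw [(hasDerivAt_freeEnergy β K x).deriv]
  refine mul_neg_of_pos_of_neg hq (sub_neg.2 ?_)
  have h := div_mul_cgfMean_lt (third_lt_spinVar hβ).le (spinVar_lt_one β)
    (mul_pos hq hx.1) (mul_lt_mul_of_pos_left hx.2 hq)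
  have h1 : 2 * β * K * x / (2 * β * K * m) * m = x := by
    rw [mul_div_mul_left _ _ hq.ne']
    field_simp
  rwa [← hcrit, h1] at h

lemma strictMonoOn_freeEnergy {β K m : ℝ} (hβ : β < betaC) (hK : 0 < β * K) (hm : 0 < m)
    (hcrit : m = cgfMean (spinVar β) (2 * β * K * m)) :
    StrictMonoOn (freeEnergy β K) (Set.Ici m) := by
  have hq : 0 < 2 * β * K := by linarith
  refine strictMonoOn_of_deriv_pos (convex_Ici m) (continuous_freeEnergy β K).continuousOn
    fun x hx => ?_
  rw [interior_Ici, Set.mem_Ioi] at hx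
  have hx0 : 0 < x := hm.trans hx
  rw [(hasDerivAt_freeEnergy β K x).deriv]
  refine mul_pos hq (sub_pos.2 ?_)
  have h := div_mul_cgfMean_lt (third_lt_spinVar hβ).le (spinVar_lt_one β)
    (mul_pos hq hm) (mul_lt_mul_of_pos_left hx hq)
  rw [← hcrit, mul_div_mul_left _ _ hq.ne', div_mul_eq_mul_div, div_lt_iff₀ hx0] at h
  exact lt_of_mul_lt_mul_left h hm.le

/-- In the phase-coexistence region the magnetization is the unique positive global minimum point
of the free-energy functional, which decreases before it and increases after it. -/
lemma magnetization_spec {β K : ℝ} (hβ : β < betaC) (hK : 0 < β * K)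
    (hneg : ∃ x, freeEnergy β K x < 0) :
    0 < magnetization β K ∧
    equilibria β K = {magnetization β K, -magnetization β K} ∧
    globalMinPoints (freeEnergy β K) = {magnetization β K, -magnetization β K} ∧
    StrictAntiOn (freeEnergy β K) (Set.Icc 0 (magnetization β K)) ∧
    StrictMonoOn (freeEnergy β K) (Set.Ici (magnetization β K)) := by
  obtain ⟨x₁, hx₁⟩ := hneg
  obtain ⟨x₀, hx₀⟩ := globalMinPoints_freeEnergy_nonempty hK
  -- A negative value of G excludes the origin, where G = 0, so the minimizers come in pairs ±m.
  have hne {x : ℝ} (hx : x ∈ globalMinPoints (freeEnergy β K)) : x ≠ 0 := by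
    rintro rfl
    have := hx x₁
    rw [freeEnergy_zero] at this
    linarith
  have hnegmem {x : ℝ} (hx : x ∈ globalMinPoints (freeEnergy β K)) :
      -x ∈ globalMinPoints (freeEnergy β K) := fun y => by
    rw [freeEnergy_neg]; exact hx y
  obtain ⟨m, hm0, hm⟩ : ∃ m, 0 < m ∧ m ∈ globalMinPoints (freeEnergy β K) := by
    rcases (hne hx₀).lt_or_gt with h | h
    · exact ⟨-x₀, neg_pos.2 h, hnegmem hx₀⟩
    · exact ⟨x₀, h, hx₀⟩
  have hcrit := eq_cgfMean_of_mem_globalMinPoints hK hm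
  have hanti := strictAntiOn_freeEnergy hβ hK hm0 hcrit
  have hmono := strictMonoOn_freeEnergy hβ hK hm0 hcrit
  have huniq {x : ℝ} (hx0 : 0 < x) (hx : x ∈ globalMinPoints (freeEnergy β K)) : x = m := by
    rcases lt_trichotomy x m with h | h | h
    · exact absurd (hx m) (hanti ⟨hx0.le, h.le⟩ ⟨hm0.le, le_rfl⟩ h).not_ge
    · exact h
    · exact absurd (hx m) (hmono Set.self_mem_Ici h.le h).not_ge
  have hset : globalMinPoints (freeEnergy β K) = {m, -m} := by
    ext x
    simp only [Set.mem_insert_iff, Set.mem_singleton_iff]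
    constructor
    · intro hx
      rcases (hne hx).lt_or_gt with h | h
      · right
        rw [← huniq (neg_pos.2 h) (hnegmem hx), neg_neg]
      · exact Or.inl (huniq h hx)
    · rintro (rfl | rfl)
      · exact hm
      · exact hnegmem hm
  have heq := (equilibria_eq_globalMinPoints hK).trans hset
  have hmag : magnetization β K = m := by
    rw [magnetization, heq, csSup_pair]
    exact max_eq_left (by linarith)
  rw [hmag]
  exact ⟨hm0, heq, hset, hanti, hmono⟩

/-! ### Second-order curve and the sequence approaching it -/

lemma curveK_pos {β : ℝ} (hβ : 0 < β) : 0 < curveK β := by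
  unfold curveK; positivity

/-- The quadratic coefficient of G is βK(1 - 2βKw), so this says that it vanishes on the curve. -/
lemma two_mul_curveK_mul_spinVar {β : ℝ} (hβ : 0 < β) : 2 * β * curveK β * spinVar β = 1 := by
  unfold curveK spinVar
  have := Real.exp_pos β
  field_simp
  norm_num

lemma contDiffOn_curveK (n : ℕ) : ContDiffOn ℝ n curveK (Set.Ioi 0) := by
  unfold curveK
  refine ContDiffOn.div (by fun_prop) (by fun_prop) fun x hx => ?_
  rw [Set.mem_Ioi] at hx
  positivity

lemma continuousAt_spinVar (β : ℝ) : ContinuousAt spinVar β := by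
  unfold spinVar
  have : Real.exp β + 2 ≠ 0 := by positivity
  fun_prop (disch := assumption)

lemma tendsto_natCast_rpow {α : ℝ} (hα : 0 < α) :
    Tendsto (fun n : ℕ => (n : ℝ) ^ α) atTop atTop :=
  (tendsto_rpow_atTop hα).comp tendsto_natCast_atTop_atTop

lemma natCast_rpow_mul (n p : ℕ) (α : ℝ) : (n : ℝ) ^ ((p : ℝ) * α) = ((n : ℝ) ^ α) ^ p := by
  rw [mul_comm, Real.rpow_mul n.cast_nonneg, Real.rpow_natCast]

lemma tendsto_betaSeq {α : ℝ} (hα : 0 < α) (β b : ℝ) :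
    Tendsto (betaSeq β α b) atTop (𝓝 β) := by
  change Tendsto (fun n => betaSeq β α b n) atTop (𝓝 β)
  simpa [betaSeq] using ((tendsto_natCast_rpow hα).const_div_atTop b).const_add β

/-- Exhibits K_n as the Taylor polynomial of degree p - 1 at β_n plus the ℓ term, ready for Taylor's
theorem. -/
lemma KSeq_eq (β α b : ℝ) {p : ℕ} (hp : 1 ≤ p) (l : ℝ) (n : ℕ) :
    KSeq β α b p l n =
      ∑ j ∈ Finset.range p,
        ((j.factorial : ℝ)⁻¹ * (b / (n : ℝ) ^ α) ^ j) * iteratedDeriv j curveK β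
      + l * (b / (n : ℝ) ^ α) ^ p / p.factorial := by
  have hIcc : Finset.Icc 1 (p - 1) = Finset.Ico 1 p := by
    ext j
    simp only [Finset.mem_Icc, Finset.mem_Ico]
    omega
  rw [KSeq, hIcc, Finset.sum_range_eq_add_Ico _ hp, iteratedDeriv_zero, natCast_rpow_mul]
  congr 1
  · congr 1
    · simp
    · refine Finset.sum_congr rfl fun j _ => ?_
      rw [natCast_rpow_mul]
      ring
  · ring

/-- The distance of `K_n` to the curve has order `n^{-pα}`. -/
lemma tendsto_rpow_mul_curveK_sub_KSeq {β α b : ℝ} (hβ : 0 < β) (hα : 0 < α) (hb : b ≠ 0) {p : ℕ}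
    (hp : 1 ≤ p) (l : ℝ) :
    Tendsto (fun n : ℕ => (n : ℝ) ^ ((p : ℝ) * α) *
        (curveK (betaSeq β α b n) - KSeq β α b p l n)) atTop
      (𝓝 ((iteratedDeriv p curveK β - l) * b ^ p / p.factorial)) := by
  have hT := taylor_tendsto (convex_Ioi (0 : ℝ)) (Set.mem_Ioi.2 hβ) (contDiffOn_curveK p)
  rw [isOpen_Ioi.nhdsWithin_eq (Set.mem_Ioi.2 hβ)] at hT
  -- With d = β_n - β = b/n^α, the Peano remainder of order p is divided by d^p, and b^p/d^p =
  -- n^{pα}. The added constant accounts for ℓ replacing the p-th derivative.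
  have h := ((hT.comp (tendsto_betaSeq hα β b)).const_mul (b ^ p)).add_const
    ((iteratedDeriv p curveK β - l) * b ^ p / p.factorial)
  rw [mul_zero, zero_add] at h
  refine h.congr' ?_
  filter_upwards [eventually_gt_atTop 0] with n hn
  have hn0 : (0 : ℝ) < (n : ℝ) ^ α := Real.rpow_pos_of_pos (by exact_mod_cast hn) α
  have hsum : ∑ j ∈ Finset.range p, ((j.factorial : ℝ)⁻¹ * (b / (n : ℝ) ^ α) ^ j) *
        iteratedDerivWithin j curveK (Set.Ioi 0) β =
      ∑ j ∈ Finset.range p, ((j.factorial : ℝ)⁻¹ * (b / (n : ℝ) ^ α) ^ j) *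
        iteratedDeriv j curveK β :=
    Finset.sum_congr rfl fun j _ => by
      rw [iteratedDerivWithin_of_isOpen isOpen_Ioi (Set.mem_Ioi.2 hβ)]
  simp only [Function.comp_apply, taylor_within_apply, smul_eq_mul, Finset.sum_range_succ]
  rw [show betaSeq β α b n - β = b / (n : ℝ) ^ α by simp [betaSeq], hsum, KSeq_eq β α b hp,
    natCast_rpow_mul, iteratedDerivWithin_of_isOpen isOpen_Ioi (Set.mem_Ioi.2 hβ)]
  obtain ⟨d, hd⟩ : ∃ d, d = b / (n : ℝ) ^ α := ⟨_, rfl⟩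
  have hd0 : d ≠ 0 := hd ▸ div_ne_zero hb hn0.ne'
  rw [← hd, (div_eq_iff hn0.ne').1 hd.symm, mul_pow]
  field_simp
  ring

lemma tendsto_KSeq {β α b : ℝ} (hβ : 0 < β) (hα : 0 < α) (hb : b ≠ 0) {p : ℕ}
    (hp : 1 ≤ p) (l : ℝ) : Tendsto (KSeq β α b p l) atTop (𝓝 (curveK β)) := by
  have hp0 : (0 : ℝ) < p := by exact_mod_cast hp
  have h1 : Tendsto (fun n => curveK (betaSeq β α b n)) atTop (𝓝 (curveK β)) :=
    (((contDiffOn_curveK 0).continuousOn.continuousAt (Ioi_mem_nhds hβ)).tendsto).comp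
      (tendsto_betaSeq hα β b)
  have h2 := (tendsto_rpow_mul_curveK_sub_KSeq hβ hα hb hp l).mul
    (tendsto_natCast_rpow (mul_pos hp0 hα)).inv_tendsto_atTop
  have h3 := h1.sub h2
  rw [mul_zero, sub_zero] at h3
  refine h3.congr' ?_
  filter_upwards [eventually_gt_atTop 0] with n hn
  have hn0 : (0 : ℝ) < (n : ℝ) ^ ((p : ℝ) * α) :=
    Real.rpow_pos_of_pos (by exact_mod_cast hn) _
  simp only [Pi.inv_apply]
  field_simp
  ring

/-! ### Scaling limit of the free energy -/

/-- Fourth-order expansion of the free-energy functional, with an explicit remainder. -/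
lemma abs_freeEnergy_sub_le {β K x : ℝ} (hβ : 0 < β) (hx : |2 * β * K * x| ≤ 1) :
    |freeEnergy β K x - (2 * β ^ 2 * K * spinVar β * (curveK β - K) * x ^ 2 -
      (spinVar β / 24 - spinVar β ^ 2 / 8) * (2 * β * K) ^ 4 * x ^ 4)| ≤
      5 * (2 * β * K * x) ^ 6 := by
  have h := abs_cgfVar_sub_le (spinVar_pos β) (spinVar_lt_one β) hx
  rw [← abs_neg]
  refine le_trans (le_of_eq ?_) h
  congr 1
  rw [freeEnergy_eq]
  -- The criticality identity turns βK(1 - 2βKw) into 2β²Kw(K(β) - K).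
  linear_combination (β * K * x ^ 2) * two_mul_curveK_mul_spinVar hβ

/-- The quartic coefficient of G on the curve; since 2βK(β) = 1/w it equals (3w - 1)/(24w³). -/
lemma c4_eq {β : ℝ} (hβ : 0 < β) :
    c4 β = -((spinVar β / 24 - spinVar β ^ 2 / 8) * (2 * β * curveK β) ^ 4) := by
  unfold c4 spinVar curveK
  have := Real.exp_pos β
  norm_num [Nat.factorial]
  field_simp
  ring

/-- Uniform convergence on compact sets of the scaled free-energy functionals. -/
lemma tendstoUniformlyOn_freeEnergy {β α b : ℝ} (hβ : 0 < β) (hα : 0 < α) (hb : b ≠ 0) {p : ℕ}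
    (hp : 1 ≤ p) (l : ℝ) {S : Set ℝ} (hS : IsCompact S) :
    TendstoUniformlyOn
      (fun (n : ℕ) (x : ℝ) => (n : ℝ) ^ (2 * (p : ℝ) * α) *
        freeEnergy (betaSeq β α b n) (KSeq β α b p l n) (x / (n : ℝ) ^ ((p : ℝ) * α / 2)))
      (glPoly β b p l) atTop S := by
  have hp0 : (0 : ℝ) < p := by exact_mod_cast hp
  obtain ⟨M, hM⟩ := hS.isBounded.exists_norm_le
  have hM0 : 0 ≤ |M| := abs_nonneg M
  have hβn := tendsto_betaSeq hα β b
  have hKn := tendsto_KSeq hβ hα hb hp l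
  have hwn := (continuousAt_spinVar β).tendsto.comp hβn
  have hqn : Tendsto (fun n => 2 * betaSeq β α b n * KSeq β α b p l n) atTop
      (𝓝 (2 * β * curveK β)) := (hβn.const_mul 2).mul hKn
  have hs := tendsto_natCast_rpow (half_pos (mul_pos hp0 hα))
  have hsi := hs.inv_tendsto_atTop
  obtain ⟨A, hA⟩ : ∃ A : ℕ → ℝ, A = fun n => betaSeq β α b n *
      (2 * betaSeq β α b n * KSeq β α b p l n) * spinVar (betaSeq β α b n) *
      ((n : ℝ) ^ ((p : ℝ) * α) * (curveK (betaSeq β α b n) - KSeq β α b p l n)) := ⟨_, rfl⟩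
  have hAl : Tendsto A atTop
      (𝓝 (1 / (p.factorial : ℝ) * β * (iteratedDeriv p curveK β - l) * b ^ p)) := by
    rw [hA]
    have hlim : 1 / (p.factorial : ℝ) * β * (iteratedDeriv p curveK β - l) * b ^ p =
        β * (2 * β * curveK β) * spinVar β *
          ((iteratedDeriv p curveK β - l) * b ^ p / p.factorial) := by
      linear_combination (-β * ((iteratedDeriv p curveK β - l) * b ^ p / p.factorial)) *
        two_mul_curveK_mul_spinVar hβ
    rw [hlim]
    exact ((hβn.mul hqn).mul hwn).mul (tendsto_rpow_mul_curveK_sub_KSeq hβ hα hb hp l)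
  obtain ⟨B, hB⟩ : ∃ B : ℕ → ℝ, B = fun n => -((spinVar (betaSeq β α b n) / 24 -
      spinVar (betaSeq β α b n) ^ 2 / 8) *
      (2 * betaSeq β α b n * KSeq β α b p l n) ^ 4) := ⟨_, rfl⟩
  have hBl : Tendsto B atTop (𝓝 (c4 β)) := by
    rw [hB, c4_eq hβ]
    exact (((hwn.div_const 24).sub ((hwn.pow 2).div_const 8)).mul (hqn.pow 4)).neg
  -- Bound for |x| ≤ |M|: the errors of the two coefficients plus the sixth-order remainder, which
  -- keeps a factor n^{-pα}.
  have hbound : Tendsto (fun n =>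
      |A n - 1 / (p.factorial : ℝ) * β * (iteratedDeriv p curveK β - l) * b ^ p| * |M| ^ 2 +
      |B n - c4 β| * |M| ^ 4 +
      5 * (2 * betaSeq β α b n * KSeq β α b p l n) ^ 6 * |M| ^ 6 *
        (((n : ℝ) ^ ((p : ℝ) * α / 2))⁻¹) ^ 2) atTop (𝓝 0) := by
    have h1 := (tendsto_sub_nhds_zero_iff.2 hAl).abs.mul_const (|M| ^ 2)
    have h2 := (tendsto_sub_nhds_zero_iff.2 hBl).abs.mul_const (|M| ^ 4)
    have h3 := (((hqn.pow 6).const_mul 5).mul_const (|M| ^ 6)).mul (hsi.pow 2)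
    simpa using (h1.add h2).add h3
  -- Brings the argument of the cumulant generating function into [-1, 1], where the expansion is
  -- valid.
  have hsmall : ∀ᶠ n : ℕ in atTop, |2 * betaSeq β α b n * KSeq β α b p l n| * |M| *
      ((n : ℝ) ^ ((p : ℝ) * α / 2))⁻¹ < 1 := by
    have h := (hqn.abs.mul_const |M|).mul hsi
    rw [mul_zero] at h
    exact h.eventually (gt_mem_nhds one_pos)
  rw [Metric.tendstoUniformlyOn_iff]
  intro ε hε
  filter_upwards [hbound.eventually (gt_mem_nhds hε), hsmall, eventually_gt_atTop 0,
    hβn.eventually (lt_mem_nhds hβ)] with n hn hn1 hn0 hβn0 x hx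
  have hxM : |x| ≤ |M| := (hM x hx).trans (le_abs_self M)
  obtain ⟨s, hs⟩ : ∃ s, s = (n : ℝ) ^ ((p : ℝ) * α / 2) := ⟨_, rfl⟩
  have hs0 : 0 < s := hs ▸ Real.rpow_pos_of_pos (by exact_mod_cast hn0) _
  have hs2 : (n : ℝ) ^ ((p : ℝ) * α) = s ^ 2 := by
    rw [hs, ← Real.rpow_natCast, ← Real.rpow_mul n.cast_nonneg]
    congr 1; push_cast; ring
  have hs4 : (n : ℝ) ^ (2 * (p : ℝ) * α) = s ^ 4 := by
    rw [hs, ← Real.rpow_natCast, ← Real.rpow_mul n.cast_nonneg]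
    congr 1; push_cast; ring
  refine lt_of_le_of_lt ?_ hn
  rw [hA, hB, dist_comm, Real.dist_eq, hs4, ← hs]
  rw [← hs] at hn1
  simp only [hs2]
  generalize betaSeq β α b n = β' at *
  generalize KSeq β α b p l n = K' at *
  have hq : |2 * β' * K' * (x / s)| ≤ 1 := by
    rw [abs_mul, abs_div, abs_of_pos hs0, div_eq_mul_inv, ← mul_assoc]
    refine le_trans ?_ hn1.le
    gcongr
  have h := abs_freeEnergy_sub_le hβn0 hq
  obtain ⟨R, hR⟩ : ∃ R, R = freeEnergy β' K' (x / s) - (2 * β' ^ 2 * K' * spinVar β' *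
      (curveK β' - K') * (x / s) ^ 2 - (spinVar β' / 24 - spinVar β' ^ 2 / 8) *
      (2 * β' * K') ^ 4 * (x / s) ^ 4) := ⟨_, rfl⟩
  rw [← hR] at h
  have hG : s ^ 4 * freeEnergy β' K' (x / s) - glPoly β b p l x =
      (β' * (2 * β' * K') * spinVar β' * (s ^ 2 * (curveK β' - K')) -
        1 / (p.factorial : ℝ) * β * (iteratedDeriv p curveK β - l) * b ^ p) * x ^ 2 +
      (-((spinVar β' / 24 - spinVar β' ^ 2 / 8) * (2 * β' * K') ^ 4) - c4 β) * x ^ 4 +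
      s ^ 4 * R := by
    rw [hR, glPoly]
    field_simp
    ring
  have hx2 : x ^ 2 ≤ |M| ^ 2 := by rw [← sq_abs x]; gcongr
  have hx4 : x ^ 4 ≤ |M| ^ 4 := by
    rw [← Even.pow_abs (by decide) x]; gcongr
  have hx6 : x ^ 6 ≤ |M| ^ 6 := by
    rw [← Even.pow_abs (by decide) x]; gcongr
  rw [hG]
  refine (abs_add_three _ _ _).trans (add_le_add_three ?_ ?_ ?_)
  · rw [abs_mul, abs_of_nonneg (sq_nonneg x)]
    gcongr
  · rw [abs_mul, abs_of_nonneg (by positivity : 0 ≤ x ^ 4)]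
    gcongr
  · rw [abs_mul, abs_of_pos (by positivity)]
    calc s ^ 4 * |R| ≤ s ^ 4 * (5 * (2 * β' * K' * (x / s)) ^ 6) := by gcongr
      _ = 5 * (2 * β' * K') ^ 6 * x ^ 6 * s⁻¹ ^ 2 := by field_simp
      _ ≤ _ := by
        have : 0 ≤ (2 * β' * K') ^ 6 := by positivity
        gcongr

@[simp] lemma glPoly_zero (β b : ℝ) (p : ℕ) (l : ℝ) : glPoly β b p l 0 = 0 := by simp [glPoly]

/-! ### Minimizers of the Ginzburg-Landau polynomial -/

section GinzburgLandau

variable {β b : ℝ} {p : ℕ} {l : ℝ}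

lemma xbar_pos (hβ0 : 0 < β) (hβ : β < betaC)
    (hlt : (iteratedDeriv p curveK β - l) * b ^ p < 0) : 0 < xbar β b p l := by
  have hc := c4_pos hβ
  refine Real.sqrt_pos.2 (div_pos ?_ (by positivity))
  nlinarith [mul_neg_of_pos_of_neg hβ0 hlt]

lemma xbar_sq (hβ0 : 0 < β) (hβ : β < betaC)
    (hlt : (iteratedDeriv p curveK β - l) * b ^ p < 0) :
    xbar β b p l ^ 2 =
      β * (l - iteratedDeriv p curveK β) * b ^ p / (2 * c4 β * (p.factorial : ℝ)) :=
  Real.sq_sqrt (Real.sqrt_pos.1 (xbar_pos hβ0 hβ hlt)).le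

/-- Completing the square: the quadratic coefficient of g is -2 c₄ x̄². -/
lemma glPoly_sub_glPoly_xbar (hβ0 : 0 < β) (hβ : β < betaC)
    (hlt : (iteratedDeriv p curveK β - l) * b ^ p < 0) (y : ℝ) :
    glPoly β b p l y - glPoly β b p l (xbar β b p l) =
      c4 β * (y ^ 2 - xbar β b p l ^ 2) ^ 2 := by
  have hc := c4_pos hβ
  have hA : 1 / (p.factorial : ℝ) * β * (iteratedDeriv p curveK β - l) * b ^ p =
      -(2 * c4 β * xbar β b p l ^ 2) := by
    rw [xbar_sq hβ0 hβ hlt]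
    field_simp
    ring
  unfold glPoly
  rw [hA]
  ring

lemma glPoly_xbar_lt (hβ0 : 0 < β) (hβ : β < betaC)
    (hlt : (iteratedDeriv p curveK β - l) * b ^ p < 0) {y : ℝ} (hy : 0 ≤ y)
    (hne : y ≠ xbar β b p l) : glPoly β b p l (xbar β b p l) < glPoly β b p l y := by
  have hc := c4_pos hβ
  have h : y ^ 2 - xbar β b p l ^ 2 ≠ 0 :=
    sub_ne_zero.2 fun h => hne ((sq_eq_sq₀ hy (xbar_pos hβ0 hβ hlt).le).1 h)
  have : 0 < c4 β * (y ^ 2 - xbar β b p l ^ 2) ^ 2 := by positivity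
  linarith [glPoly_sub_glPoly_xbar hβ0 hβ hlt y]

lemma globalMinPoints_glPoly (hβ0 : 0 < β) (hβ : β < betaC)
    (hlt : (iteratedDeriv p curveK β - l) * b ^ p < 0) :
    globalMinPoints (glPoly β b p l) = {xbar β b p l, -xbar β b p l} := by
  have hc := c4_pos hβ
  ext x
  rw [Set.mem_insert_iff, Set.mem_singleton_iff, ← sq_eq_sq_iff_eq_or_eq_neg]
  constructor
  · intro hx
    have h := hx (xbar β b p l)
    have h1 : c4 β * (x ^ 2 - xbar β b p l ^ 2) ^ 2 ≤ 0 := by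
      linarith [glPoly_sub_glPoly_xbar hβ0 hβ hlt x]
    have h2 := nonpos_of_mul_nonpos_right h1 hc
    have h3 := pow_eq_zero_iff two_ne_zero |>.1 (le_antisymm h2 (sq_nonneg _))
    linarith
  · intro hx y
    have h1 := glPoly_sub_glPoly_xbar hβ0 hβ hlt x
    have h2 := glPoly_sub_glPoly_xbar hβ0 hβ hlt y
    rw [hx, sub_self] at h1
    have : 0 ≤ c4 β * (y ^ 2 - xbar β b p l ^ 2) ^ 2 := by positivity
    linarith

lemma exists_ne_zero_mem_globalMinPoints_glPoly_iff (hβ0 : 0 < β) (hβ : β < betaC) :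
    (∃ x ∈ globalMinPoints (glPoly β b p l), x ≠ 0) ↔
      (iteratedDeriv p curveK β - l) * b ^ p < 0 := by
  have hc := c4_pos hβ
  constructor
  · rintro ⟨x, hx, hx0⟩
    have h := hx 0
    rw [glPoly_zero] at h
    by_contra! hA
    have h4 : 0 < c4 β * x ^ 4 := by positivity
    have h2 : 0 ≤ 1 / (p.factorial : ℝ) * β * ((iteratedDeriv p curveK β - l) * b ^ p) * x ^ 2 := by
      positivity
    rw [← mul_assoc] at h2
    unfold glPoly at h
    linarith
  · intro hlt
    refine ⟨xbar β b p l, ?_, (xbar_pos hβ0 hβ hlt).ne'⟩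
    rw [globalMinPoints_glPoly hβ0 hβ hlt]
    exact Set.mem_insert _ _

end GinzburgLandau

/-! ### Asymptotics of the magnetization -/

section Asymptotics

variable {β α b : ℝ} {p : ℕ} {l : ℝ}

/-- Pointwise convergence of the scaled free-energy functionals. -/
lemma tendsto_freeEnergy (hβ0 : 0 < β) (hα : 0 < α) (hb : b ≠ 0) (hp : 1 ≤ p) (l x : ℝ) :
    Tendsto (fun n : ℕ => (n : ℝ) ^ (2 * (p : ℝ) * α) *
        freeEnergy (betaSeq β α b n) (KSeq β α b p l n) (x / (n : ℝ) ^ ((p : ℝ) * α / 2)))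
      atTop (𝓝 (glPoly β b p l x)) :=
  (tendstoUniformlyOn_freeEnergy hβ0 hα hb hp l isCompact_singleton).tendsto_at
    (Set.mem_singleton x)

lemma eventually_freeEnergy_lt (hβ0 : 0 < β) (hα : 0 < α) (hb : b ≠ 0) (hp : 1 ≤ p) {x y : ℝ}
    (hxy : glPoly β b p l x < glPoly β b p l y) :
    ∀ᶠ n : ℕ in atTop,
      freeEnergy (betaSeq β α b n) (KSeq β α b p l n) (x / (n : ℝ) ^ ((p : ℝ) * α / 2)) <
      freeEnergy (betaSeq β α b n) (KSeq β α b p l n) (y / (n : ℝ) ^ ((p : ℝ) * α / 2)) := by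
  filter_upwards [(tendsto_freeEnergy hβ0 hα hb hp l x).eventually_lt
    (tendsto_freeEnergy hβ0 hα hb hp l y) hxy] with n hn
  exact lt_of_mul_lt_mul_left hn (by positivity)

lemma eventually_magnetization_spec (hβ0 : 0 < β) (hβ : β < betaC) (hα : 0 < α) (hb : b ≠ 0)
    (hp : 1 ≤ p) (hlt : (iteratedDeriv p curveK β - l) * b ^ p < 0) :
    ∀ᶠ n : ℕ in atTop,
      0 < magnetization (betaSeq β α b n) (KSeq β α b p l n) ∧
      equilibria (betaSeq β α b n) (KSeq β α b p l n) =
        {magnetization (betaSeq β α b n) (KSeq β α b p l n),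
          -magnetization (betaSeq β α b n) (KSeq β α b p l n)} ∧
      globalMinPoints (freeEnergy (betaSeq β α b n) (KSeq β α b p l n)) =
        {magnetization (betaSeq β α b n) (KSeq β α b p l n),
          -magnetization (betaSeq β α b n) (KSeq β α b p l n)} ∧
      StrictAntiOn (freeEnergy (betaSeq β α b n) (KSeq β α b p l n))
        (Set.Icc 0 (magnetization (betaSeq β α b n) (KSeq β α b p l n))) ∧
      StrictMonoOn (freeEnergy (betaSeq β α b n) (KSeq β α b p l n))
        (Set.Ici (magnetization (betaSeq β α b n) (KSeq β α b p l n))) := by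
  have hβn := tendsto_betaSeq hα β b
  filter_upwards [hβn.eventually (gt_mem_nhds hβ),
    (hβn.mul (tendsto_KSeq hβ0 hα hb hp l)).eventually
      (lt_mem_nhds (mul_pos hβ0 (curveK_pos hβ0))),
    -- Since g(x̄) < g(0), eventually G is negative at x̄/n^{pα/2}.
    eventually_freeEnergy_lt hβ0 hα hb hp
      (glPoly_xbar_lt hβ0 hβ hlt le_rfl (xbar_pos hβ0 hβ hlt).ne)] with n h1 h2 h3
  rw [zero_div, freeEnergy_zero] at h3
  exact magnetization_spec h1 h2 ⟨_, h3⟩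

/-- If the scaled magnetization were at most some 0 ≤ a < x̄, G would increase from a to x̄ in
scaled coordinates, against g(x̄) < g(a). A value a > x̄ is excluded likewise, by the decrease of G
before m. -/
lemma tendsto_rpow_mul_magnetization (hβ0 : 0 < β) (hβ : β < betaC) (hα : 0 < α) (hb : b ≠ 0)
    (hp : 1 ≤ p) (hlt : (iteratedDeriv p curveK β - l) * b ^ p < 0) :
    Tendsto (fun n : ℕ => (n : ℝ) ^ ((p : ℝ) * α / 2) *
      magnetization (betaSeq β α b n) (KSeq β α b p l n)) atTop (𝓝 (xbar β b p l)) := by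
  have hx := xbar_pos hβ0 hβ hlt
  have hspec := eventually_magnetization_spec hβ0 hβ hα hb hp hlt
  refine tendsto_order.2 ⟨fun a ha => ?_, fun a ha => ?_⟩
  -- Truncation at 0, because x̄ is the strict minimizer of g only on the nonnegative half-line.
  · have ha' : max a 0 < xbar β b p l := max_lt ha hx
    filter_upwards [hspec, eventually_gt_atTop 0, eventually_freeEnergy_lt hβ0 hα hb hp
      (glPoly_xbar_lt hβ0 hβ hlt (le_max_right a 0) ha'.ne)] with n ⟨_, _, _, _, hmono⟩ hn hlt'
    have hs : 0 < (n : ℝ) ^ ((p : ℝ) * α / 2) := Real.rpow_pos_of_pos (by exact_mod_cast hn) _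
    refine (le_max_left a 0).trans_lt ?_
    by_contra! h
    have h1 := (le_div_iff₀' hs).2 h
    have h2 := div_lt_div_of_pos_right ha' hs
    exact (hmono h1 (h1.trans h2.le) h2).not_gt hlt'
  · filter_upwards [hspec, eventually_gt_atTop 0, eventually_freeEnergy_lt hβ0 hα hb hp
      (glPoly_xbar_lt hβ0 hβ hlt (hx.trans ha).le ha.ne')] with n ⟨_, _, _, hanti, _⟩ hn hlt'
    have hs : 0 < (n : ℝ) ^ ((p : ℝ) * α / 2) := Real.rpow_pos_of_pos (by exact_mod_cast hn) _
    by_contra! h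
    have h1 := (div_le_iff₀' hs).2 h
    have h2 := div_lt_div_of_pos_right ha hs
    have h0 := (div_pos hx hs).le
    exact (hanti ⟨h0, h2.le.trans h1⟩ ⟨h0.trans h2.le, h1⟩ h2).not_gt hlt'

end Asymptotics

end BlumeCapel

theorem theorem3p2 (β α b : ℝ) (p : ℕ) (l : ℝ)
    (hβ0 : 0 < β) (hβc : β < BlumeCapel.betaC) (hα : 0 < α) (hb : b = 1 ∨ b = -1)
    (hp : 2 ≤ p) (hl : l ≠ iteratedDeriv p BlumeCapel.curveK β) :
    -- the sequence converges to the second-order point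
    Tendsto (fun n : ℕ => (BlumeCapel.betaSeq β α b n, BlumeCapel.KSeq β α b p l n))
      atTop (𝓝 (β, BlumeCapel.curveK β)) ∧
    -- (a) convergence of the scaled free energies, uniformly on compact sets
    (∀ u γ : ℝ, u = 1 - 2 * (p : ℝ) * α → γ = (p : ℝ) * α / 2 →
      ∀ S : Set ℝ, IsCompact S →
        TendstoUniformlyOn
          (fun (n : ℕ) (x : ℝ) => (n : ℝ) ^ (1 - u) *
            BlumeCapel.freeEnergy (BlumeCapel.betaSeq β α b n) (BlumeCapel.KSeq β α b p l n)
              (x / (n : ℝ) ^ γ))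
          (BlumeCapel.glPoly β b p l) atTop S) ∧
    -- (b) global minimum points of the Ginzburg-Landau polynomial
    ((∃ x ∈ BlumeCapel.globalMinPoints (BlumeCapel.glPoly β b p l), x ≠ 0) ↔
      (iteratedDeriv p BlumeCapel.curveK β - l) * b ^ p < 0) ∧
    ((iteratedDeriv p BlumeCapel.curveK β - l) * b ^ p < 0 →
      0 < BlumeCapel.xbar β b p l ∧
      BlumeCapel.globalMinPoints (BlumeCapel.glPoly β b p l) =
        {BlumeCapel.xbar β b p l, -BlumeCapel.xbar β b p l}) ∧
    -- (c) asymptotics of the magnetization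
    ((iteratedDeriv p BlumeCapel.curveK β - l) * b ^ p < 0 →
      -- for large `n` the point lies in the phase-coexistence region, and `m` is the
      -- unique positive equilibrium value and unique positive global minimum point of `G`
      (∀ᶠ n : ℕ in atTop,
        0 < BlumeCapel.magnetization (BlumeCapel.betaSeq β α b n)
              (BlumeCapel.KSeq β α b p l n) ∧
        BlumeCapel.equilibria (BlumeCapel.betaSeq β α b n) (BlumeCapel.KSeq β α b p l n) =
          {BlumeCapel.magnetization (BlumeCapel.betaSeq β α b n) (BlumeCapel.KSeq β α b p l n),
           -BlumeCapel.magnetization (BlumeCapel.betaSeq β α b n)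
              (BlumeCapel.KSeq β α b p l n)} ∧
        BlumeCapel.globalMinPoints
            (BlumeCapel.freeEnergy (BlumeCapel.betaSeq β α b n)
              (BlumeCapel.KSeq β α b p l n)) =
          {BlumeCapel.magnetization (BlumeCapel.betaSeq β α b n) (BlumeCapel.KSeq β α b p l n),
           -BlumeCapel.magnetization (BlumeCapel.betaSeq β α b n)
              (BlumeCapel.KSeq β α b p l n)}) ∧
      Tendsto (fun n : ℕ => BlumeCapel.magnetization (BlumeCapel.betaSeq β α b n)
          (BlumeCapel.KSeq β α b p l n)) atTop (𝓝 0) ∧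
      Tendsto (fun n : ℕ => (n : ℝ) ^ ((p : ℝ) * α / 2) *
          BlumeCapel.magnetization (BlumeCapel.betaSeq β α b n)
            (BlumeCapel.KSeq β α b p l n)) atTop (𝓝 (BlumeCapel.xbar β b p l)) ∧
      Asymptotics.IsEquivalent atTop
        (fun n : ℕ => BlumeCapel.magnetization (BlumeCapel.betaSeq β α b n)
          (BlumeCapel.KSeq β α b p l n))
        (fun n : ℕ => BlumeCapel.xbar β b p l *
          |β - BlumeCapel.betaSeq β α b n| ^ ((p : ℝ) / 2))) := by
  have hb0 : b ≠ 0 := by rcases hb with rfl | rfl <;> norm_num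
  have hb1 : |b| = 1 := by rcases hb with rfl | rfl <;> norm_num
  have hp1 : 1 ≤ p := by omega
  have hp0 : (0 : ℝ) < p := by exact_mod_cast hp1
  refine ⟨(BlumeCapel.tendsto_betaSeq hα β b).prodMk_nhds
      (BlumeCapel.tendsto_KSeq hβ0 hα hb0 hp1 l), ?_,
    BlumeCapel.exists_ne_zero_mem_globalMinPoints_glPoly_iff hβ0 hβc,
    fun hlt => ⟨BlumeCapel.xbar_pos hβ0 hβc hlt,
      BlumeCapel.globalMinPoints_glPoly hβ0 hβc hlt⟩, fun hlt => ?_⟩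
  · rintro u γ rfl rfl S hS
    rw [sub_sub_cancel]
    exact BlumeCapel.tendstoUniformlyOn_freeEnergy hβ0 hα hb0 hp1 l hS
  have hx := BlumeCapel.xbar_pos hβ0 hβc hlt
  have hspec := BlumeCapel.eventually_magnetization_spec hβ0 hβc hα hb0 hp1 hlt
  have hlim := BlumeCapel.tendsto_rpow_mul_magnetization hβ0 hβc hα hb0 hp1 hlt
  refine ⟨hspec.mono fun n h => ⟨h.1, h.2.1, h.2.2.1⟩, ?_, hlim, ?_⟩
  · have h := hlim.mul
      (BlumeCapel.tendsto_natCast_rpow (half_pos (mul_pos hp0 hα))).inv_tendsto_atTop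
    rw [mul_zero] at h
    refine h.congr' ?_
    filter_upwards [eventually_gt_atTop 0] with n hn
    have hs : 0 < (n : ℝ) ^ ((p : ℝ) * α / 2) := Real.rpow_pos_of_pos (by exact_mod_cast hn) _
    rw [Pi.inv_apply]
    field_simp
  · refine Asymptotics.isEquivalent_of_tendsto_one ?_
    have h := hlim.div_const (BlumeCapel.xbar β b p l)
    rw [div_self hx.ne'] at h
    refine h.congr' ?_
    filter_upwards [eventually_gt_atTop 0] with n hn
    have hn0 : (0 : ℝ) < n := by exact_mod_cast hn
    have hs : 0 < (n : ℝ) ^ ((p : ℝ) * α / 2) := Real.rpow_pos_of_pos hn0 _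
    -- Because |b| = 1, the distance |β - β_n| is exactly n^{-α}.
    have hdist : |β - BlumeCapel.betaSeq β α b n| ^ ((p : ℝ) / 2) =
        ((n : ℝ) ^ ((p : ℝ) * α / 2))⁻¹ := by
      rw [BlumeCapel.betaSeq, sub_add_cancel_left, abs_neg, abs_div, hb1,
        abs_of_pos (Real.rpow_pos_of_pos hn0 α), one_div, Real.inv_rpow (by positivity),
        ← Real.rpow_mul hn0.le]
      congr 2
      ring
    rw [Pi.div_apply, hdist]
    field_simp
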